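/- All graphs are finite, simple and undirected. For a graph $H$, a graph is $H$-free if it has no induced subgraph isomorphic to $H$. Let $P_5$ be the path on five vertices, and let the diamond be the complete graph $K_4$ minus one edge. In the game of cops and robber on a connected graph, first each of $k$ cops is placed on a vertex (several cops may share a vertex), then the robber chooses a vertex, and then the cops and the robber move alternately, the cops first, with full information; in a turn of the cops each cop, and in a turn of the robber the robber, stays at its vertex or moves to an adjacent one. The cops win if after finitely many turns some cop and the robber are at the same vertex; otherwise the robber wins. The cop number $\mathrm{cop}(G)$ of a graph $G$ is the minimum $k$ such that $k$ cops have a winning strategy in each connected component of $G$. Theorem. Let $G$ be a connected graph that is both $P_5$-free and diamond-free. Then $\mathrm{cop}(G)\le 2$. -/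

import Mathlib

namespace CopsRobber

universe u

variable {V : Type u}

/-- A valid move of a single player (a cop or the robber) from `x` to `y`:
stay at the current vertex or go to an adjacent one. -/
def IsMove (G : SimpleGraph V) (x y : V) : Prop :=
  x = y ∨ G.Adj x y

/-- A (history dependent) strategy of a team of `k` cops on `G`. The cops choose their initial
vertices (several cops may share a vertex); afterwards `move h c` is the new position of the team
when it is the cops' turn, the cops are at `c` and `h` is the list of all positions
of the robber so far, the current one first. Every cop makes a valid move. -/
structure CopStrategy (G : SimpleGraph V) (k : ℕ) where
  start : Fin k → V
  move : List V → (Fin k → V) → (Fin k → V)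
  move_valid : ∀ h c i, IsMove G (c i) (move h c i)

/-- The list `[r n, ..., r 1, r 0]` of the first `n + 1` positions of the robber. -/
def history (r : ℕ → V) : ℕ → List V
  | 0 => [r 0]
  | n + 1 => r (n + 1) :: history r n

/-- A play of the robber on `G`: an initial vertex `r 0`, followed by valid moves. -/
def IsRobberPlay (G : SimpleGraph V) (r : ℕ → V) : Prop :=
  ∀ n, IsMove G (r n) (r (n + 1))

/-- The position of the cops after `n` of their moves, when they follow the strategy `σ`
and the robber plays `r`. The order of the turns is: `cops 0`, `r 0`, `cops 1`, `r 1`, .... -/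
def CopStrategy.cops {G : SimpleGraph V} {k : ℕ} (σ : CopStrategy G k) (r : ℕ → V) :
    ℕ → Fin k → V
  | 0 => σ.start
  | n + 1 => σ.move (history r n) (σ.cops r n)

/-- The strategy `σ` wins if against every play of the robber, after finitely many turns a cop and
the robber are at the same vertex: either just after the robber's turn that takes it to `r n`,
or just after the cops' turn that follows. -/
def CopStrategy.Wins {G : SimpleGraph V} {k : ℕ} (σ : CopStrategy G k) : Prop :=
  ∀ r : ℕ → V, IsRobberPlay G r →
    ∃ (n : ℕ) (i : Fin k), σ.cops r n i = r n ∨ σ.cops r (n + 1) i = r n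

/-- `k` cops win the game on `G`. -/
def CopsWin (G : SimpleGraph V) (k : ℕ) : Prop :=
  ∃ σ : CopStrategy G k, σ.Wins

/-- The cop number of `G`: the minimum number `k` such that `k` cops win in each
connected component of `G` (it is `⊤` if there is no such `k`). -/
noncomputable def copNumber (G : SimpleGraph V) : ℕ∞ :=
  ⨅ (k : ℕ) (_ : ∀ C : G.ConnectedComponent, CopsWin C.toSimpleGraph k), (k : ℕ∞)

/-- The diamond: the complete graph on four vertices minus one edge. -/
def diamond : SimpleGraph (Fin 4) :=
  (⊤ : SimpleGraph (Fin 4)).deleteEdges {s(0, 1)}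

/-- `G` is `H`-free: no induced subgraph of `G` is isomorphic to `H`. -/
def IndFree {W : Type*} (H : SimpleGraph W) (G : SimpleGraph V) : Prop :=
  ¬ H.IsIndContained G

end CopsRobber

/-!
Play with two cops on adjacent vertices `u`, `v` and the robber on `d`, at distance at least two
from both. Diamond-freeness says that the common neighbours of two adjacent vertices form a clique
and those of two distinct non-adjacent vertices an independent set.

The crucial case is that `u` has a common neighbour `x` with `d` that is not adjacent to `v`. If
some neighbour of `d` is adjacent to neither cop, then moving `u → x` traps the robber, since any
escape would create a `P₅` or a diamond. Otherwise every neighbour of `d` is guarded by a cop. If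
at most one of them is guarded by `v` alone, a single move traps the robber. If there are several,
the edges between the neighbours guarded by `u` alone and those guarded by `v` alone meet the
former in at most one vertex, as two disjoint such edges would span a `P₅` through `u`. Moving the
cop from `u` to that vertex forces the robber into a position where moving `v → u` traps it.

Any other position is one move away from this case, because a connected `P₅`-free graph has
diameter at most three.
-/

namespace CopsRobber

variable {V W : Type*} {G : SimpleGraph V} {k n : ℕ}

theorem IsMove.refl (x : V) : IsMove G x x := Or.inl rfl

theorem not_isMove {x y : V} : ¬ IsMove G x y ↔ x ≠ y ∧ ¬ G.Adj x y := not_or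

/-! ### Forced wins -/

/-- The team of cops at `c`, to move, can catch the robber at `r` within `n` of its moves. A cop
that the robber runs into catches it by staying, so a catch by the robber's own move needs no
clause of its own. -/
def ForcedWin (G : SimpleGraph V) : ℕ → (Fin k → V) → V → Prop
  | 0, _, _ => False
  | n + 1, c, r => ∃ c' : Fin k → V, (∀ i, IsMove G (c i) (c' i)) ∧
      ((∃ i, c' i = r) ∨ ∀ r', IsMove G r r' → ForcedWin G n c' r')

theorem ForcedWin.mono_succ {c : Fin k → V} {r : V} (h : ForcedWin G n c r) :
    ForcedWin G (n + 1) c r := by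
  induction n generalizing c r with
  | zero => exact h.elim
  | succ n ih =>
    obtain ⟨c', hc, h⟩ := h
    exact ⟨c', hc, h.imp_right fun h r' hr ↦ ih (h r' hr)⟩

theorem ForcedWin.mono {m : ℕ} {c : Fin k → V} {r : V} (h : ForcedWin G m c r) (hmn : m ≤ n) :
    ForcedWin G n c r :=
  Nat.le_induction h (fun _ _ ih ↦ ih.mono_succ) n hmn

theorem exists_optimal_move (G : SimpleGraph V) (c : Fin k → V) (r : V) :
    ∃ c' : Fin k → V, (∀ i, IsMove G (c i) (c' i)) ∧ ∀ n, ForcedWin G (n + 1) c r →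
      (∃ i, c' i = r) ∨ ∀ r', IsMove G r r' → ForcedWin G n c' r' := by
  classical
  by_cases h : ∃ n, ForcedWin G (n + 1) c r
  · obtain ⟨c', hc, hwin⟩ := Nat.find_spec h
    exact ⟨c', hc, fun n hn ↦ hwin.imp_right fun hwin r' hr ↦
      (hwin r' hr).mono (Nat.find_min' h hn)⟩
  · exact ⟨c, fun i ↦ .refl _, fun n hn ↦ (h ⟨n, hn⟩).elim⟩

/-- The memoryless strategy that starts at `c` and answers every position with a move that is
optimal for `ForcedWin`. The value at the empty history, which never occurs, is arbitrary. -/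
noncomputable def optimalStrategy (G : SimpleGraph V) (c : Fin k → V) : CopStrategy G k where
  start := c
  move
    | [], c => c
    | r :: _, c => (exists_optimal_move G c r).choose
  move_valid
    | [], _, _ => .refl _
    | r :: _, c, i => (exists_optimal_move G c r).choose_spec.1 i

theorem optimalStrategy_cops_succ (c : Fin k → V) (r : ℕ → V) (m : ℕ) :
    (optimalStrategy G c).cops r (m + 1) =
      (exists_optimal_move G ((optimalStrategy G c).cops r m) (r m)).choose := by
  cases m <;> rfl

theorem optimalStrategy_catches {c : Fin k → V} {r : ℕ → V} (hr : IsRobberPlay G r) {m : ℕ}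
    (h : ForcedWin G n ((optimalStrategy G c).cops r m) (r m)) :
    ∃ l i, (optimalStrategy G c).cops r (l + 1) i = r l := by
  induction n generalizing m with
  | zero => exact h.elim
  | succ n ih =>
    have hopt := (exists_optimal_move G _ _).choose_spec.2 n h
    rw [← optimalStrategy_cops_succ] at hopt
    obtain ⟨i, hi⟩ | hopt := hopt
    · exact ⟨m, i, hi⟩
    · exact ih (hopt _ (hr m))

theorem copsWin_of_forcedWin {c : Fin k → V} (h : ∀ r, ∃ n, ForcedWin G n c r) :
    CopsWin G k := by
  refine ⟨optimalStrategy G c, fun r hr ↦ ?_⟩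
  obtain ⟨n, hn⟩ := h (r 0)
  obtain ⟨l, i, hi⟩ := optimalStrategy_catches (m := 0) hr hn
  exact ⟨l, i, Or.inr hi⟩

theorem forcedWin_of_isMove {c : Fin k → V} {r : V} (i : Fin k) (h : IsMove G (c i) r) :
    ForcedWin G (n + 1) c r := by
  refine ⟨Function.update c i r, fun j ↦ ?_, Or.inl ⟨i, Function.update_self ..⟩⟩
  obtain rfl | hj := eq_or_ne j i
  · rwa [Function.update_self]
  · rw [Function.update_of_ne hj]
    exact .refl _

theorem forcedWin_pair_of_isMove {a b r : V} (h : IsMove G a r ∨ IsMove G b r) :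
    ForcedWin G (n + 1) ![a, b] r :=
  h.elim (forcedWin_of_isMove (c := ![a, b]) 0) (forcedWin_of_isMove (c := ![a, b]) 1)

theorem forcedWin_pair_step {a b a' b' r : V} (ha : IsMove G a a') (hb : IsMove G b b')
    (h : ∀ r', IsMove G r r' → ¬ IsMove G a' r' → ¬ IsMove G b' r' →
      ForcedWin G (n + 1) ![a', b'] r') :
    ForcedWin G (n + 2) ![a, b] r := by
  refine ⟨![a', b'], Fin.forall_fin_two.2 ⟨ha, hb⟩, Or.inr fun r' hr ↦ ?_⟩
  by_cases hcaught : IsMove G a' r' ∨ IsMove G b' r'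
  · exact forcedWin_pair_of_isMove hcaught
  · exact h r' hr (not_or.1 hcaught).1 (not_or.1 hcaught).2

theorem forcedWin_pair_of_trapped {a b a' b' r : V} (ha : IsMove G a a') (hb : IsMove G b b')
    (h : ∀ r', IsMove G r r' → IsMove G a' r' ∨ IsMove G b' r') :
    ForcedWin G (n + 2) ![a, b] r :=
  forcedWin_pair_step ha hb fun r' hr ha' hb' ↦ ((h r' hr).elim ha' hb').elim

/-! ### Induced paths and diamonds -/

theorem IndFree.of_isIndContained {H : SimpleGraph W} {U : Type*} {G' : SimpleGraph U}
    (h : IndFree H G) (hG : G'.IsIndContained G) : IndFree H G' :=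
  fun hH ↦ h (hH.trans hG)

theorem isIndContained_of_neighborSet_injective {H : SimpleGraph W}
    (hH : Function.Injective H.neighborSet) {f : W → V}
    (hf : ∀ i j, G.Adj (f i) (f j) ↔ H.Adj i j) : H.IsIndContained G := by
  refine ⟨⟨⟨f, fun i j hij ↦ hH (Set.ext fun l ↦ ?_)⟩, @fun i j ↦ hf i j⟩⟩
  rw [SimpleGraph.mem_neighborSet, SimpleGraph.mem_neighborSet, ← hf, ← hf, hij]

theorem neighborSet_pathGraph_five_injective :
    Function.Injective (SimpleGraph.pathGraph 5).neighborSet := by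
  have hdec : ∀ i j : Fin 5, (∀ l : Fin 5, (i.val + 1 = l.val ∨ l.val + 1 = i.val) ↔
      (j.val + 1 = l.val ∨ l.val + 1 = j.val)) → i = j := by decide
  exact fun i j hij ↦ hdec i j fun l ↦ by
    simpa only [SimpleGraph.mem_neighborSet, SimpleGraph.pathGraph_adj] using Set.ext_iff.1 hij l

theorem IndFree.false_of_induced_path (h : IndFree (SimpleGraph.pathGraph 5) G) {a b c d e : V}
    (hab : G.Adj a b) (hbc : G.Adj b c) (hcd : G.Adj c d) (hde : G.Adj d e)
    (hac : ¬ G.Adj a c) (had : ¬ G.Adj a d) (hae : ¬ G.Adj a e)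
    (hbd : ¬ G.Adj b d) (hbe : ¬ G.Adj b e) (hce : ¬ G.Adj c e) : False := by
  refine h (isIndContained_of_neighborSet_injective neighborSet_pathGraph_five_injective
    (f := ![a, b, c, d, e]) fun i j ↦ ?_)
  rw [SimpleGraph.pathGraph_adj]
  fin_cases i <;> fin_cases j <;> simp [*, G.adj_comm]

theorem IndFree.isClique_commonNeighbors (h : IndFree diamond G) {c d : V} (hcd : G.Adj c d) :
    G.IsClique (G.commonNeighbors c d) := by
  rintro a ⟨hca, hda⟩ b ⟨hcb, hdb⟩ hab
  rw [SimpleGraph.mem_neighborSet] at hca hda hcb hdb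
  by_contra hn
  have hadj : ∀ i j, G.Adj (![a, b, c, d] i) (![a, b, c, d] j) ↔ diamond.Adj i j := by
    intro i j
    fin_cases i <;> fin_cases j <;> simp [diamond, *, G.adj_comm]
  refine h ⟨⟨⟨![a, b, c, d], fun i j hij ↦ ?_⟩, @fun i j ↦ hadj i j⟩⟩
  fin_cases i <;> fin_cases j <;> simp_all

theorem IndFree.isIndepSet_commonNeighbors (h : IndFree diamond G) {u d : V}
    (hud : ¬ IsMove G u d) : G.IsIndepSet (G.commonNeighbors u d) :=
  fun _ ha _ hb _ hab ↦ (not_isMove.1 hud).2 <|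
    h.isClique_commonNeighbors hab ⟨ha.1.symm, hb.1.symm⟩ ⟨ha.2.symm, hb.2.symm⟩
      (not_isMove.1 hud).1

theorem IndFree.subsingleton_commonNeighbors_inter_neighborSet (h : IndFree diamond G)
    {u d y : V} (hud : ¬ IsMove G u d) (hdy : G.Adj d y) :
    (G.commonNeighbors u d ∩ G.neighborSet y).Subsingleton := by
  rintro a ⟨ha, hya⟩ b ⟨hb, hyb⟩
  by_contra hab
  exact h.isIndepSet_commonNeighbors hud ha hb hab
    (h.isClique_commonNeighbors hdy ⟨ha.2, hya⟩ ⟨hb.2, hyb⟩ hab)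

/-! ### Shortest walks -/

theorem dist_getVert_getVert {u v : V} {p : G.Walk u v} (hp : p.length = G.dist u v) {i j : ℕ}
    (hij : i ≤ j) (hj : j ≤ p.length) : G.dist (p.getVert i) (p.getVert j) = j - i := by
  have hsub := ((p.take j).isSubwalk_drop i).trans (p.isSubwalk_take j)
  have hlen := SimpleGraph.length_eq_dist_of_subwalk hp hsub
  rw [SimpleGraph.Walk.drop_length, SimpleGraph.Walk.take_length, min_eq_left hj,
    SimpleGraph.Walk.take_getVert, min_eq_right hij] at hlen
  exact hlen.symm

theorem pathGraph_isIndContained_of_le_dist {u v : V} (huv : G.Reachable u v)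
    (hn : n ≤ G.dist u v) : (SimpleGraph.pathGraph (n + 1)).IsIndContained G := by
  obtain ⟨p, hp⟩ := huv.exists_walk_length_eq_dist
  have hdist (i j : Fin (n + 1)) : G.dist (p.getVert i) (p.getVert j) = j - i + (i - j) := by
    obtain hij | hij := le_total i j
    · rw [dist_getVert_getVert hp hij (by omega)]
      omega
    · rw [SimpleGraph.dist_comm, dist_getVert_getVert hp hij (by omega)]
      omega
  have hinj : Function.Injective fun i : Fin (n + 1) ↦ p.getVert i := fun i j hij ↦ by
    have hzero := hdist i j
    rw [show p.getVert i = p.getVert j from hij, SimpleGraph.dist_self] at hzero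
    omega
  have hadj (i j : Fin (n + 1)) :
      G.Adj (p.getVert i) (p.getVert j) ↔ (SimpleGraph.pathGraph (n + 1)).Adj i j := by
    rw [SimpleGraph.pathGraph_adj, ← SimpleGraph.dist_eq_one_iff_adj, hdist]
    omega
  exact ⟨⟨⟨_, hinj⟩, @fun i j ↦ hadj i j⟩⟩

theorem IndFree.dist_le (h : IndFree (SimpleGraph.pathGraph (n + 2)) G) (u v : V) :
    G.dist u v ≤ n := by
  by_contra! hn
  have huv : G.Reachable u v := .of_dist_ne_zero (by omega)
  exact h (pathGraph_isIndContained_of_le_dist huv hn)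

theorem IndFree.exists_walk_length_three (hP : IndFree (SimpleGraph.pathGraph 5) G)
    (hG : G.Connected) {u d : V} (hud : ¬ IsMove G u d) (hcn : G.commonNeighbors u d = ∅) :
    ∃ a b, G.Adj u a ∧ G.Adj a b ∧ G.Adj b d := by
  obtain ⟨p, hp⟩ := hG.exists_walk_length_eq_dist u d
  have hlen : p.length ≤ 3 := hp.trans_le (hP.dist_le u d)
  match p with
  | .nil => exact (hud (.refl u)).elim
  | .cons hud' .nil => exact (hud (Or.inr hud')).elim
  | .cons hux (.cons hxd .nil) =>
    exact (Set.eq_empty_iff_forall_notMem.1 hcn _ ⟨hux, hxd.symm⟩).elim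
  | .cons hua (.cons hab (.cons hbd .nil)) => exact ⟨_, _, hua, hab, hbd⟩
  | .cons _ (.cons _ (.cons _ (.cons _ _))) =>
    simp only [SimpleGraph.Walk.length_cons] at hlen
    omega

/-! ### Two cops on adjacent vertices -/

/-- The common neighbours of `u` and `d` that are not adjacent to `v`: the neighbours of a robber
at `d` that are guarded by a cop at `u` but not by a cop at `v`. -/
def privateNeighbors (G : SimpleGraph V) (u v d : V) : Set V :=
  G.commonNeighbors u d \ G.neighborSet v

variable {u v d : V}

theorem mem_privateNeighbors {x : V} :
    x ∈ privateNeighbors G u v d ↔ G.Adj u x ∧ G.Adj d x ∧ ¬ G.Adj v x :=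
  and_assoc

theorem forcedWin_of_unguarded_neighbor (hP : IndFree (SimpleGraph.pathGraph 5) G)
    (hD : IndFree diamond G) (huv : G.Adj u v) (hud : ¬ G.Adj u d) (hvd : ¬ G.Adj v d) {x e : V}
    (hx : x ∈ privateNeighbors G u v d) (hde : G.Adj d e) (hue : ¬ G.Adj u e)
    (hve : ¬ G.Adj v e) : ForcedWin G 2 ![u, v] d := by
  have hcomplete : ∀ y ∈ privateNeighbors G u v d, ∀ f, G.Adj d f → ¬ G.Adj u f →
      ¬ G.Adj v f → G.Adj y f := by
    rintro y ⟨⟨huy, hdy⟩, hvy⟩ f hdf huf hvf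
    by_contra hyf
    exact hP.false_of_induced_path huv.symm huy hdy.symm hdf hvy hvd hvf hud huf hyf
  refine forcedWin_pair_of_trapped (Or.inr hx.1.1) (.refl v) ?_
  rintro r (rfl | hdr)
  · exact Or.inl (Or.inr hx.1.2.symm)
  by_cases hvr : G.Adj v r
  · exact Or.inr (Or.inr hvr)
  refine Or.inl (or_iff_not_imp_left.2 fun hxr ↦ ?_)
  by_cases hur : G.Adj u r
  · have hr : r ∈ privateNeighbors G u v d := mem_privateNeighbors.2 ⟨hur, hdr, hvr⟩
    exact hD.isClique_commonNeighbors hde ⟨hx.1.2, (hcomplete x hx e hde hue hve).symm⟩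
      ⟨hdr, (hcomplete r hr e hde hue hve).symm⟩ hxr
  · exact hcomplete x hx r hdr hur hvr

theorem forcedWin_of_subsingleton_privateNeighbors (huv : G.Adj u v) {x : V}
    (hguard : ∀ e, G.Adj d e → G.Adj u e ∨ G.Adj v e) (hx : x ∈ privateNeighbors G u v d)
    (hsub : (privateNeighbors G v u d).Subsingleton) : ForcedWin G 2 ![u, v] d := by
  have hprivate (r : V) (hdr : G.Adj d r) (hur : ¬ G.Adj u r) : r ∈ privateNeighbors G v u d :=
    mem_privateNeighbors.2 ⟨(hguard r hdr).resolve_left hur, hdr, hur⟩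
  obtain hempty | ⟨y, hy⟩ := hsub.eq_empty_or_singleton
  · refine forcedWin_pair_of_trapped (Or.inr hx.1.1) (Or.inr huv.symm) ?_
    rintro r (rfl | hdr)
    · exact Or.inl (Or.inr hx.1.2.symm)
    · refine Or.inr (Or.inr (by_contra fun hur ↦ ?_))
      exact Set.eq_empty_iff_forall_notMem.1 hempty r (hprivate r hdr hur)
  · obtain ⟨⟨hvy, hdy⟩, -⟩ : y ∈ privateNeighbors G v u d := hy ▸ rfl
    refine forcedWin_pair_of_trapped (.refl u) (Or.inr hvy) ?_
    rintro r (rfl | hdr)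
    · exact Or.inr (Or.inr hdy.symm)
    · refine or_iff_not_imp_left.2 fun hur ↦ Or.inl ?_
      exact (hy ▸ hprivate r hdr (not_isMove.1 hur).2 : r ∈ ({y} : Set V)).symm

theorem eq_of_adj_privateNeighbors (hP : IndFree (SimpleGraph.pathGraph 5) G)
    (hD : IndFree diamond G) (hud : ¬ IsMove G u d) (hvd : ¬ IsMove G v d) {x₁ x₂ y₁ y₂ : V}
    (hx₁ : x₁ ∈ privateNeighbors G u v d) (hx₂ : x₂ ∈ privateNeighbors G u v d)
    (hy₁ : y₁ ∈ privateNeighbors G v u d) (hy₂ : y₂ ∈ privateNeighbors G v u d)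
    (h₁ : G.Adj x₁ y₁) (h₂ : G.Adj x₂ y₂) : x₁ = x₂ := by
  by_contra hne
  have hmatch (y : V) (hy : y ∈ privateNeighbors G v u d) (hxy₁ : G.Adj x₁ y) : ¬ G.Adj x₂ y :=
    fun hxy₂ ↦ hne <| hD.subsingleton_commonNeighbors_inter_neighborSet hud hy.1.2
      ⟨hx₁.1, hxy₁.symm⟩ ⟨hx₂.1, hxy₂.symm⟩
  have hx : ¬ G.Adj x₁ x₂ := hD.isIndepSet_commonNeighbors hud hx₁.1 hx₂.1 hne
  have hy : ¬ G.Adj y₁ y₂ := hD.isIndepSet_commonNeighbors hvd hy₁.1 hy₂.1 fun h ↦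
    hmatch y₁ hy₁ h₁ (h ▸ h₂)
  exact hP.false_of_induced_path h₁.symm hx₁.1.1.symm hx₂.1.1 h₂ (fun h ↦ hy₁.2 h.symm)
    (fun h ↦ hmatch y₁ hy₁ h₁ h.symm) hy hx (fun h ↦ hmatch y₂ hy₂ h h₂) hy₂.2

theorem exists_mem_privateNeighbors_forall_ne_not_adj (hP : IndFree (SimpleGraph.pathGraph 5) G)
    (hD : IndFree diamond G) (hud : ¬ IsMove G u d) (hvd : ¬ IsMove G v d)
    (hne : (privateNeighbors G u v d).Nonempty) :
    ∃ x₁ ∈ privateNeighbors G u v d, ∀ x₂ ∈ privateNeighbors G u v d, x₂ ≠ x₁ →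
      ∀ y ∈ privateNeighbors G v u d, ¬ G.Adj x₂ y := by
  by_cases hedge : ∃ x₁ ∈ privateNeighbors G u v d, ∃ y₁ ∈ privateNeighbors G v u d, G.Adj x₁ y₁
  · obtain ⟨x₁, hx₁, y₁, hy₁, h₁⟩ := hedge
    exact ⟨x₁, hx₁, fun x₂ hx₂ hx y₂ hy₂ h₂ ↦
      hx (eq_of_adj_privateNeighbors hP hD hud hvd hx₂ hx₁ hy₂ hy₁ h₂ h₁)⟩
  · obtain ⟨x, hx⟩ := hne
    exact ⟨x, hx, fun x₂ hx₂ _ y hy h ↦ hedge ⟨x₂, hx₂, y, hy, h⟩⟩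

theorem exists_mem_privateNeighbors_not_adj (hD : IndFree diamond G) (hvd : ¬ IsMove G v d)
    (hnt : (privateNeighbors G v u d).Nontrivial) {x : V} (hdx : G.Adj d x) :
    ∃ y ∈ privateNeighbors G v u d, ¬ G.Adj x y := by
  obtain ⟨y, hy, y', hy', hne⟩ := hnt
  by_contra! hall
  exact hne <| hD.subsingleton_commonNeighbors_inter_neighborSet hvd hdx
    ⟨hy.1, hall y hy⟩ ⟨hy'.1, hall y' hy'⟩

theorem forcedWin_of_robber_mem_privateNeighbors (hP : IndFree (SimpleGraph.pathGraph 5) G)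
    (huv : G.Adj u v) (hvd : ¬ G.Adj v d) (hguard : ∀ e, G.Adj d e → G.Adj u e ∨ G.Adj v e)
    {x₁ x₂ y : V} (hx₁ : x₁ ∈ privateNeighbors G u v d) (hx₂ : x₂ ∈ privateNeighbors G u v d)
    (hx₁₂ : ¬ G.Adj x₁ x₂) (hx₂y : ∀ y ∈ privateNeighbors G v u d, ¬ G.Adj x₂ y)
    (hy : y ∈ privateNeighbors G v u d) (hx₁y : ¬ G.Adj x₁ y) :
    ForcedWin G 2 ![x₁, v] x₂ := by
  obtain ⟨hux₁, hdx₁, hvx₁⟩ := mem_privateNeighbors.1 hx₁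
  obtain ⟨hux₂, hdx₂, hvx₂⟩ := mem_privateNeighbors.1 hx₂
  obtain ⟨hvy, hdy, huy⟩ := mem_privateNeighbors.1 hy
  refine forcedWin_pair_of_trapped (.refl x₁) (Or.inr huv.symm) ?_
  rintro z (rfl | hx₂z)
  · exact Or.inr (Or.inr hux₂)
  by_contra! hescape
  obtain ⟨-, hx₁z⟩ := not_isMove.1 hescape.1
  obtain ⟨-, huz⟩ := not_isMove.1 hescape.2
  have hdz : ¬ G.Adj d z := fun h ↦
    hx₂y z (mem_privateNeighbors.2 ⟨(hguard z h).resolve_left huz, h, huz⟩) hx₂z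
  have hzv : ¬ G.Adj z v := fun h ↦
    hP.false_of_induced_path hdx₁.symm hdx₂ hx₂z h hx₁₂ hx₁z (fun h ↦ hvx₁ h.symm) hdz
      (fun h ↦ hvd h.symm) (fun h ↦ hvx₂ h.symm)
  have hzy : G.Adj z y := by
    by_contra h
    exact hP.false_of_induced_path hx₂z.symm hdx₂.symm hdy hvy.symm (fun h ↦ hdz h.symm) h hzv
      (hx₂y y hy) (fun h ↦ hvx₂ h.symm) (fun h ↦ hvd h.symm)
  exact hP.false_of_induced_path hux₁.symm hux₂ hx₂z hzy hx₁₂ hx₁z hx₁y huz huy (hx₂y y hy)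

theorem forcedWin_of_nontrivial_privateNeighbors (hP : IndFree (SimpleGraph.pathGraph 5) G)
    (hD : IndFree diamond G) (huv : G.Adj u v) (hud : ¬ IsMove G u d) (hvd : ¬ IsMove G v d)
    (hguard : ∀ e, G.Adj d e → G.Adj u e ∨ G.Adj v e)
    (hne : (privateNeighbors G u v d).Nonempty)
    (hnt : (privateNeighbors G v u d).Nontrivial) : ForcedWin G 3 ![u, v] d := by
  obtain ⟨x₁, hx₁, hcross⟩ := exists_mem_privateNeighbors_forall_ne_not_adj hP hD hud hvd hne
  obtain ⟨y, hy, hx₁y⟩ := exists_mem_privateNeighbors_not_adj hD hvd hnt hx₁.1.2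
  refine forcedWin_pair_step (Or.inr hx₁.1.1) (.refl v) ?_
  rintro x₂ (rfl | hdx₂) hx₁₂ hvx₂
  · exact (hx₁₂ (Or.inr hx₁.1.2.symm)).elim
  rw [not_isMove] at hx₁₂ hvx₂
  have hx₂ : x₂ ∈ privateNeighbors G u v d :=
    mem_privateNeighbors.2 ⟨(hguard x₂ hdx₂).resolve_right hvx₂.2, hdx₂, hvx₂.2⟩
  exact forcedWin_of_robber_mem_privateNeighbors hP huv (not_isMove.1 hvd).2 hguard hx₁ hx₂
    hx₁₂.2 (hcross x₂ hx₂ hx₁₂.1.symm) hy hx₁y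

theorem forcedWin_of_nonempty_privateNeighbors (hP : IndFree (SimpleGraph.pathGraph 5) G)
    (hD : IndFree diamond G) (huv : G.Adj u v) (hne : (privateNeighbors G u v d).Nonempty) :
    ForcedWin G 3 ![u, v] d := by
  by_cases hnear : IsMove G u d ∨ IsMove G v d
  · exact forcedWin_pair_of_isMove hnear
  obtain ⟨hud, hvd⟩ := not_or.1 hnear
  obtain ⟨x, hx⟩ := hne
  by_cases hguard : ∀ e, G.Adj d e → G.Adj u e ∨ G.Adj v e
  · obtain hsub | hnt := (privateNeighbors G v u d).subsingleton_or_nontrivial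
    · exact (forcedWin_of_subsingleton_privateNeighbors huv hguard hx hsub).mono_succ
    · exact forcedWin_of_nontrivial_privateNeighbors hP hD huv hud hvd hguard ⟨x, hx⟩ hnt
  · push Not at hguard
    obtain ⟨e, hde, hue, hve⟩ := hguard
    exact (forcedWin_of_unguarded_neighbor hP hD huv (not_isMove.1 hud).2 (not_isMove.1 hvd).2
      hx hde hue hve).mono_succ

theorem forcedWin_of_mem_commonNeighbors (hP : IndFree (SimpleGraph.pathGraph 5) G)
    (hD : IndFree diamond G) (huv : G.Adj u v) (hvd : ¬ G.Adj v d) {w : V}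
    (hw : w ∈ G.commonNeighbors u d) : ForcedWin G 4 ![u, v] d := by
  by_cases hvw : G.Adj v w
  · refine forcedWin_pair_step (Or.inr hw.1) (.refl v) ?_
    rintro r (rfl | hdr) hwr -
    · exact (hwr (Or.inr hw.2.symm)).elim
    · exact forcedWin_of_nonempty_privateNeighbors hP hD hvw.symm
        ⟨d, mem_privateNeighbors.2 ⟨hw.2.symm, hdr.symm, hvd⟩⟩
  · exact (forcedWin_of_nonempty_privateNeighbors hP hD huv ⟨w, hw, hvw⟩).mono_succ

theorem forcedWin_of_commonNeighbors_eq_empty (hG : G.Connected)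
    (hP : IndFree (SimpleGraph.pathGraph 5) G) (hD : IndFree diamond G) (huv : G.Adj u v)
    (hud : ¬ IsMove G u d) (hcn : G.commonNeighbors u d = ∅) : ForcedWin G 4 ![u, v] d := by
  obtain ⟨a, b, hua, hab, hbd⟩ := hP.exists_walk_length_three hG hud hcn
  have hnot (w : V) (huw : G.Adj u w) : ¬ G.Adj w d := fun hwd ↦
    Set.eq_empty_iff_forall_notMem.1 hcn w ⟨huw, hwd.symm⟩
  have hub : ¬ G.Adj u b := fun hub ↦ hnot b hub hbd
  refine forcedWin_pair_step (Or.inr hua) (Or.inr huv.symm) ?_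
  intro r hdr har hur
  rw [not_isMove] at har hur hud
  have hbr : G.Adj b r := by
    obtain rfl | hdr := hdr
    · exact hbd
    · by_contra hbr
      exact hP.false_of_induced_path hua hab hbd hdr hub hud.2 hur.2 (hnot a hua) har.2 hbr
  exact forcedWin_of_nonempty_privateNeighbors hP hD hua.symm
    ⟨b, mem_privateNeighbors.2 ⟨hab, hbr.symm, hub⟩⟩

theorem forcedWin_of_adj (hG : G.Connected) (hP : IndFree (SimpleGraph.pathGraph 5) G)
    (hD : IndFree diamond G) (huv : G.Adj u v) (d : V) : ForcedWin G 4 ![u, v] d := by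
  by_cases hnear : IsMove G u d ∨ IsMove G v d
  · exact forcedWin_pair_of_isMove hnear
  obtain ⟨hud, hvd⟩ := not_or.1 hnear
  obtain hcn | ⟨w, hw⟩ := (G.commonNeighbors u d).eq_empty_or_nonempty
  · exact forcedWin_of_commonNeighbors_eq_empty hG hP hD huv hud hcn
  · exact forcedWin_of_mem_commonNeighbors hP hD huv (not_isMove.1 hvd).2 hw

theorem copsWin_two (hG : G.Connected) (hP : IndFree (SimpleGraph.pathGraph 5) G)
    (hD : IndFree diamond G) : CopsWin G 2 := by
  obtain ⟨u⟩ := hG.nonempty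
  cases subsingleton_or_nontrivial V
  · exact copsWin_of_forcedWin (c := ![u, u]) fun d ↦
      ⟨1, forcedWin_pair_of_isMove (Or.inl (Or.inl (Subsingleton.elim u d)))⟩
  · obtain ⟨v, huv⟩ := hG.preconnected.exists_adj_of_nontrivial u
    exact copsWin_of_forcedWin (c := ![u, v]) fun d ↦ ⟨4, forcedWin_of_adj hG hP hD huv d⟩

end CopsRobber

theorem theorem6p1p1_general {V : Type*} (G : SimpleGraph V)
    (hP5 : CopsRobber.IndFree (SimpleGraph.pathGraph 5) G)
    (hdiamond : CopsRobber.IndFree CopsRobber.diamond G) :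
    CopsRobber.copNumber G ≤ 2 := by
  refine iInf₂_le 2 fun C ↦ ?_
  have hC : C.toSimpleGraph.IsIndContained G := ⟨SimpleGraph.Embedding.induce _⟩
  exact CopsRobber.copsWin_two C.connected_toSimpleGraph (hP5.of_isIndContained hC)
    (hdiamond.of_isIndContained hC)

theorem theorem6p1p1 {V : Type*} [Finite V] (G : SimpleGraph V) (hconn : G.Connected)
    (hP5 : CopsRobber.IndFree (SimpleGraph.pathGraph 5) G)
    (hdiamond : CopsRobber.IndFree CopsRobber.diamond G) :
    CopsRobber.copNumber G ≤ 2 :=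
  theorem6p1p1_general G hP5 hdiamond
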